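/- Definitions. For an abstract simplicial complex $\mathcal K$ on a finite vertex set $V$, the geometric realization $|\mathcal K|\subset\mathbb R^V$ is the union of the convex hulls of $\{e_v\}_{v\in\sigma}$ for $\sigma\in\mathcal K$. A placement $p\colon V\to\mathbb R^3$ extends uniquely to a map $|\mathcal K|\to\mathbb R^3$ that is affine on every simplex. The placement is called an embedded polyhedron if $|\mathcal K|$ is homeomorphic to the $2$-sphere and this map is injective. A flex of $p$ is a map $f\colon[0,1)\to(\mathbb R^3)^V$ such that $f$ is continuous, $f(0)=p$, for every $\tau\in[0,1)$ the placement $f(\tau)$ sends the two endpoints of each edge of $\mathcal K$ to distinct points and induces the same edge lengths as $p$, and for $\tau_1\ne\tau_2$ the placements $f(\tau_1)$ and $f(\tau_2)$ are not related by a direct isometry of $\mathbb R^3$. The flex has no self-intersections if $f(\tau)$ is an embedded polyhedron for every $\tau\in[0,1)$. Let $\mathbb S$ be the subdivided pentagonal bipyramid, that is, the complex on the eight vertices $\mathsf T,\mathsf B,1,2,3,4,5,\mathsf N$ whose simplices are the subsets of $$\{\mathsf T,1,2\},\{\mathsf T,2,3\},\{\mathsf T,3,4\},\{\mathsf T,4,5\},\{\mathsf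 T,5,1\},\{\mathsf B,2,3\},\{\mathsf B,3,4\},\{\mathsf B,4,5\},\{\mathsf B,5,1\},\{\mathsf N,\mathsf B,1\},\{\mathsf N,1,2\},\{\mathsf N,\mathsf B,2\}$$ (the pentagonal bipyramid with its face $\{\mathsf B,1,2\}$ subdivided into three). For real parameters $(t,a,x_3,y_3,z_3,\mu)$ let $R_1=\operatorname{diag}(1,-1,-1)$ and $$R_2=\begin{pmatrix}c&s&0\\ s&-c&0\\ 0&0&-1\end{pmatrix},\qquad c=\frac{t^2-1}{t^2+1},\quad s=\frac{2t}{t^2+1},$$ which are reflections across two lines through the origin in the plane $z=0$. The Nelson construction (gluing two line-symmetric octahedra) places the vertices of the pentagonal bipyramid at $$p_{\mathsf T}=(0,0,a),\quad p_{\mathsf B}=(0,0,-a),\quad p_3=(x_3,y_3,z_3),\quad p_1=R_1p_3,\quad p_5=R_2p_3,\quad p_2=R_1p_0,\quad p_4=R_2p_0,$$ where $p_0=\mu p_1+(1-\mu)p_5$. Theorem. Let $\rho$ be the realization of $\mathbb S$ that places $\mathsf T,\mathsf B,1,\dots,5$ by the Nelson construction with $(t,a,x_3,y_3,z_3,\mu)=(-5/8,\,1,\,15/7,\,11/4,\,5/2,\,2/7)$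 and places $\mathsf N$ at $$p_1-\tfrac{9}{10}(p_2-p_1)+3(p_{\mathsf B}-p_1)+\tfrac35\,(p_2-p_1)\times(p_{\mathsf B}-p_1).$$ Then $\rho$ has a flex with no self-intersections. Hence there exists a flexible embedded polyhedron with $8$ vertices, that is, a placement of a simplicial complex with exactly $8$ vertices that is an embedded polyhedron and has a flex with no self-intersections. -/

import Mathlib

open scoped Matrix

noncomputable section

namespace FlexiblePolyhedron

/-- Euclidean three-space. -/
abbrev E3 : Type := EuclideanSpace ℝ (Fin 3)

/-! ### Realizations of graphs, congruence and flexes -/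

section Graph

variable {V : Type*}

/-- A realization of a graph in space: adjacent vertices are mapped to distinct points. -/
def IsRealization (G : SimpleGraph V) (p : V → E3) : Prop :=
  ∀ u v, G.Adj u v → p u ≠ p v

/-- Two placements of the vertices induce the same edge lengths. -/
def SameEdgeLengths (G : SimpleGraph V) (p q : V → E3) : Prop :=
  ∀ u v, G.Adj u v → dist (p u) (p v) = dist (q u) (q v)

/-- Two placements are congruent if a direct (orientation-preserving) isometry of space carries
one to the other. -/
def Congruent (p q : V → E3) : Prop :=
  ∃ g : E3 ≃ᵃⁱ[ℝ] E3,
    LinearMap.det (g.linearIsometryEquiv.toLinearEquiv : E3 →ₗ[ℝ] E3) = 1 ∧ ∀ v, g (p v) = q v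

/-- `f`, restricted to `[0,1)`, is a flex of the realization `p` of the graph `G`. The values of
`f` outside `[0,1)` are irrelevant. -/
structure IsFlex (G : SimpleGraph V) (p : V → E3) (f : ℝ → V → E3) : Prop where
  continuousOn : ContinuousOn f (Set.Ico 0 1)
  start : f 0 = p
  isRealization : ∀ t ∈ Set.Ico (0 : ℝ) 1, IsRealization G (f t)
  sameEdgeLengths : ∀ t ∈ Set.Ico (0 : ℝ) 1, SameEdgeLengths G (f t) p
  not_congruent : ∀ t₁ ∈ Set.Ico (0 : ℝ) 1, ∀ t₂ ∈ Set.Ico (0 : ℝ) 1, t₁ ≠ t₂ →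
    ¬ Congruent (f t₁) (f t₂)

end Graph

/-! ### Polyhedra as realizations of abstract simplicial complexes -/

section Complex

variable {V : Type*} [Fintype V] [DecidableEq V]

/-- The abstract simplicial complex whose simplices are the nonempty subsets of members of `F`. -/
def complexOfFacets (F : Finset (Finset V)) : PreAbstractSimplicialComplex V where
  faces := {σ | σ.Nonempty ∧ ∃ τ ∈ F, σ ⊆ τ}
  isRelLowerSet_faces := fun _ hσ =>
    ⟨hσ.1, fun _ hle hne => ⟨hne, hσ.2.imp fun _ hτ => ⟨hτ.1, hle.trans hτ.2⟩⟩⟩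

/-- The graph given by the vertices and the edges of a complex. -/
def edgeGraph (K : PreAbstractSimplicialComplex V) : SimpleGraph V where
  Adj u v := u ≠ v ∧ ({u, v} : Finset V) ∈ K
  symm := ⟨fun u v h => ⟨h.1.symm, Finset.pair_comm u v ▸ h.2⟩⟩
  loopless := ⟨fun _ h => h.1 rfl⟩

/-- The geometric realization `|K|`: the union in `ℝ^V` of the convex hulls of the sets of
standard basis vectors belonging to the simplices of `K`. -/
def geometricRealization (K : PreAbstractSimplicialComplex V) : Set (V → ℝ) :=
  ⋃ σ ∈ K, convexHull ℝ ((fun v => Pi.single v (1 : ℝ)) '' (σ : Set V))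

/-- The map `|K| → ℝ³` that is affine on every simplex and sends the vertex `v` to `p v`. -/
def realizationMap (K : PreAbstractSimplicialComplex V) (p : V → E3) :
    geometricRealization K → E3 :=
  fun x => ∑ v, (x : V → ℝ) v • p v

/-- The realization of `K` determined by the vertex positions `p` is an embedded polyhedron:
`|K|` is homeomorphic to a two-sphere and the realization is injective on `|K|`. -/
def IsEmbeddedPolyhedron (K : PreAbstractSimplicialComplex V) (p : V → E3) : Prop :=
  Nonempty (geometricRealization K ≃ₜ Metric.sphere (0 : E3) 1) ∧
    Function.Injective (realizationMap K p)

/-- `f` is a flex of the embedded polyhedron `p`, i.e. a flex without self-intersections. -/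
def IsEmbeddedFlex (K : PreAbstractSimplicialComplex V) (p : V → E3) (f : ℝ → V → E3) : Prop :=
  IsFlex (edgeGraph K) p f ∧ ∀ t ∈ Set.Ico (0 : ℝ) 1, IsEmbeddedPolyhedron K (f t)

end Complex

/-! ### The subdivided pentagonal bipyramid -/

/-- The vertices: the apices `T` and `B`, the equator `v1, …, v5`, and the additional vertex `N`. -/
inductive Vertex : Type
  | T | B | v1 | v2 | v3 | v4 | v5 | N
  deriving DecidableEq

open Vertex

instance : Fintype Vertex where
  elems := {T, B, v1, v2, v3, v4, v5, N}
  complete := fun x => by cases x <;> decide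

/-- The triangles of the pentagonal bipyramid. -/
def bipyramidFacets : Finset (Finset Vertex) :=
  {{T, v1, v2}, {T, v2, v3}, {T, v3, v4}, {T, v4, v5}, {T, v5, v1},
   {B, v1, v2}, {B, v2, v3}, {B, v3, v4}, {B, v4, v5}, {B, v5, v1}}

/-- The subdivided pentagonal bipyramid: the face `{B, 1, 2}` of the pentagonal bipyramid is
replaced by the three faces `{N, B, 1}`, `{N, 1, 2}` and `{N, B, 2}`. -/
def subdividedBipyramid : PreAbstractSimplicialComplex Vertex :=
  complexOfFacets (bipyramidFacets.erase {B, v1, v2} ∪ {{N, B, v1}, {N, v1, v2}, {N, B, v2}})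

/-! ### The Nelson construction from two line-symmetric octahedra -/

/-- The reflection across the line `ℓ₁`, the `x`-axis. -/
def reflection₁ (p : E3) : E3 := !₂[p 0, -p 1, -p 2]

/-- The reflection across the line `ℓ₂` spanned by `(t, 1, 0)`, i.e. the multiplication by the
matrix with rows `(c, s, 0)`, `(s, -c, 0)`, `(0, 0, -1)`. -/
def reflection₂ (t : ℝ) (p : E3) : E3 :=
  let c := (t ^ 2 - 1) / (t ^ 2 + 1)
  let s := 2 * t / (t ^ 2 + 1)
  !₂[c * p 0 + s * p 1, s * p 0 - c * p 1, -p 2]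

/-- The positions of the vertices of the pentagonal bipyramid given by the Nelson construction
with parameters `(t, a, x₃, y₃, z₃, μ)`. The extra argument `n` is the position of `N`.
The auxiliary point `p₀` is the position of the common vertex `0` of the two octahedra that is
removed: the octahedron with opposite pairs `{0, 2}`, `{1, 3}`, `{T, B}` is symmetric with respect
to `ℓ₁`, and that with opposite pairs `{0, 4}`, `{3, 5}`, `{T, B}` with respect to `ℓ₂`. -/
def nelsonPosition (t a x₃ y₃ z₃ μ : ℝ) (n : E3) : Vertex → E3 :=
  let p₃ : E3 := !₂[x₃, y₃, z₃]
  let p₁ : E3 := reflection₁ p₃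
  let p₅ : E3 := reflection₂ t p₃
  let p₀ : E3 := μ • p₁ + (1 - μ) • p₅
  fun
  | T => !₂[0, 0, a]
  | B => !₂[0, 0, -a]
  | v1 => p₁
  | v2 => reflection₁ p₀
  | v3 => p₃
  | v4 => reflection₂ t p₀
  | v5 => p₅
  | N => n

/-- The cross product on Euclidean three-space. -/
def cross (u v : E3) : E3 := WithLp.toLp 2 (u.ofLp ⨯₃ v.ofLp)

/-- The position of the additional vertex in terms of the positions of `1`, `2` and `B`. -/
def newVertex (p₁ p₂ pB : E3) : E3 :=
  p₁ - (9 / 10 : ℝ) • (p₂ - p₁) + (3 : ℝ) • (pB - p₁) + (3 / 5 : ℝ) • cross (p₂ - p₁) (pB - p₁)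

/-- The realization of the subdivided pentagonal bipyramid with Nelson parameters
`(-5/8, 1, 15/7, 11/4, 5/2, 2/7)`. -/
def specialRealization : Vertex → E3 :=
  let b : Vertex → E3 := nelsonPosition (-5 / 8) 1 (15 / 7) (11 / 4) (5 / 2) (2 / 7) 0
  nelsonPosition (-5 / 8) 1 (15 / 7) (11 / 4) (5 / 2) (2 / 7) (newVertex (b v1) (b v2) (b B))

end FlexiblePolyhedron

end

/-!
The Nelson construction is flexible for an elementary reason. The two reflections of the construction
exchange `T` and `B`, and the removed vertex `p₀` divides the segment from `p₁` to `p₅` in a fixed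
ratio, so by Stewart's theorem every edge length is determined by four quantities
(`dist_nelsonPosition`): with `r² = x² + y²`, these are `r² + z² + a²`, `a z`, `r² / (t² + 1)` and
`μ |p₁ p₃|² + (1 - μ) |p₅ p₃|²`. As there are five parameters `t, a, x, y, z`, a curve of solutions
is expected. It is found explicitly with `s = z² + a² - 29/4` as time: `a`, `z` and `t` are linear
combinations of square roots of affine functions of `s`, and in the double-angle coordinates `x² - y²`,
`2 x y` the remaining equations cut a circle by a line, transversely at the special parameters
(`exists_continuation_of_transverse`). The additional vertex is carried along rigidly by the triangle
`v1 v2 B`. Since `a z` is constant and `2 a` is the distance of the apices, `s` is determined by the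
congruence class, so no two positions are congruent.

Absence of self-intersections is an open condition. Two facets are separated off their common face by
a plane that contains the common face; if this holds for all pairs of facets, then the realization is
injective (`injective_realizationMap_of_separatedBy`). At the special realization, such planes are
given by integer vectors, or by cross products of integer vectors with the common edge, and the
strict inequalities that express the separation persist for nearby placements
(`eventually_injective_realizationMap`).

Finally, the complex is a sphere, since it is the combinatorial type of a complete simplicial fan:
radial projection is a homeomorphism whose inverse is given by explicit piecewise linear functions
(`geometricRealizationHomeomorphSphere`).
-/

noncomputable section

namespace FlexiblePolyhedron

open Vertex Filter Topology

/-! ### Points of the geometric realization -/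

section Complex

variable {V : Type*} [Fintype V] [DecidableEq V]

/-- Barycentric coordinates: a point of `|K|` is a probability vector supported on a facet. -/
lemma mem_geometricRealization_complexOfFacets {F : Finset (Finset V)} {x : V → ℝ} :
    x ∈ geometricRealization (complexOfFacets F) ↔
      (∀ v, 0 ≤ x v) ∧ ∑ v, x v = 1 ∧ ∃ σ ∈ F, ∀ v ∉ σ, x v = 0 := by
  constructor
  · intro hx
    obtain ⟨σ, hσ, hx⟩ := Set.mem_iUnion₂.1 hx
    obtain ⟨-, τ, hτ, hστ⟩ := hσ
    have hconv : Convex ℝ {y : V → ℝ | (∀ v, 0 ≤ y v) ∧ ∑ v, y v = 1 ∧ ∀ v ∉ τ, y v = 0} := by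
      rintro y ⟨hy0, hy1, hyτ⟩ z ⟨hz0, hz1, hzτ⟩ a b ha hb hab
      refine ⟨fun v => ?_, ?_, fun v hv => ?_⟩
      · have := hy0 v
        have := hz0 v
        simp only [Pi.add_apply, Pi.smul_apply, smul_eq_mul]
        positivity
      · simp [Finset.sum_add_distrib, ← Finset.mul_sum, hy1, hz1, hab]
      · simp [hyτ v hv, hzτ v hv]
    obtain ⟨h0, h1, h2⟩ := convexHull_min (t := {y : V → ℝ | (∀ v, 0 ≤ y v) ∧ ∑ v, y v = 1 ∧
      ∀ v ∉ τ, y v = 0}) (by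
        rintro _ ⟨v, hv, rfl⟩
        refine ⟨fun u => ?_, by simp, fun u hu => ?_⟩
        · by_cases h : u = v <;> simp [h]
        · have : u ≠ v := fun h => hu (h ▸ hστ hv)
          simp [this]) hconv hx
    exact ⟨h0, h1, τ, hτ, h2⟩
  · rintro ⟨h0, h1, σ, hσ, h2⟩
    have hsum : ∑ v ∈ σ, x v = 1 := by
      rw [← h1]
      exact Finset.sum_subset (Finset.subset_univ σ) fun v _ hv => h2 v hv
    have hne : σ.Nonempty := by
      by_contra h
      simp [Finset.not_nonempty_iff_eq_empty.1 h] at hsum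
    refine Set.mem_iUnion₂.2 ⟨σ, ⟨hne, σ, hσ, subset_rfl⟩, ?_⟩
    have hx : x = ∑ v ∈ σ, x v • (Pi.single v (1 : ℝ) : V → ℝ) := by
      ext u
      by_cases hu : u ∈ σ
      · simp [Finset.sum_apply, Pi.single_apply, hu]
      · simp [Finset.sum_apply, Pi.single_apply, hu, h2 u hu]
    rw [hx]
    exact (convex_convexHull ℝ _).sum_mem (fun v _ => h0 v) hsum
      fun v hv => subset_convexHull ℝ _ ⟨v, hv, rfl⟩

/-- An injective realization sends adjacent vertices to distinct points. -/
lemma isRealization_of_injective {F : Finset (Finset V)} {p : V → E3}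
    (h : Function.Injective (realizationMap (complexOfFacets F) p)) :
    IsRealization (edgeGraph (complexOfFacets F)) p := by
  rintro u v ⟨huv, -, σ, hσ, hsub⟩ hp
  have hmem : ∀ w ∈ ({u, v} : Finset V),
      (Pi.single w 1 : V → ℝ) ∈ geometricRealization (complexOfFacets F) := fun w hw =>
    mem_geometricRealization_complexOfFacets.2 ⟨fun z => by
      by_cases h : z = w <;> simp [h], by simp, σ, hσ, fun z hz => by
      have : z ≠ w := fun h => hz (h ▸ hsub hw)
      simp [this]⟩
  have := @h ⟨_, hmem u (by simp)⟩ ⟨_, hmem v (by simp)⟩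
    (by simp [realizationMap, Pi.single_apply, hp])
  have := congrFun (Subtype.ext_iff.1 this) u
  simp [huv] at this

end Complex

/-! ### Injectivity by separating planes -/

/-- The standard bilinear form in three variables, over any commutative ring. -/
def dot {R : Type*} [CommRing R] (n q : Fin 3 → R) : R := n 0 * q 0 + n 1 * q 1 + n 2 * q 2

/-- The linear functional with coefficients `n` is constant on the common vertices of the triangles
`σ` and `τ`, and separates the remaining vertices of `σ` from those of `τ` strictly. -/
def SeparatedBy {V R : Type*} [CommRing R] [LinearOrder R] (q : V → Fin 3 → R) (σ τ : Finset V)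
    (n : Fin 3 → R) : Prop :=
  ∀ v ∈ σ, ∀ u ∈ τ, (v ∉ τ ∨ u ∉ σ) → dot n (q v) < dot n (q u)

/-- The functional with coefficients `n` takes a single value on the vertices of `σ`. -/
def ConstantOn {V R : Type*} [CommRing R] (q : V → Fin 3 → R) (σ : Finset V) (n : Fin 3 → R) :
    Prop :=
  ∀ v ∈ σ, ∀ u ∈ σ, dot n (q v) = dot n (q u)

lemma dot_neg_left {R : Type*} [CommRing R] (n q : Fin 3 → R) : dot (-n) q = -dot n q := by
  simp only [dot, Pi.neg_apply]; ring

lemma dot_realizationMap {V : Type*} [Fintype V] (p : V → E3) (n : Fin 3 → ℝ) (x : V → ℝ) :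
    dot n (∑ v, x v • p v : E3).ofLp = ∑ v, x v * dot n (p v).ofLp := by
  simp only [dot, WithLp.ofLp_sum, WithLp.ofLp_smul, Finset.sum_apply, Pi.smul_apply, smul_eq_mul,
    Finset.mul_sum, ← Finset.sum_add_distrib]
  exact Finset.sum_congr rfl fun v _ => by ring

section Complex

variable {V : Type*} [Fintype V] [DecidableEq V]

/-- If two triangles are separated off their common face, then a common point of their images has
its barycentric coordinates supported on the common face. -/
lemma eq_zero_of_separatedBy {p : V → E3} {σ τ : Finset V} {n : Fin 3 → ℝ}
    (hs : SeparatedBy (fun v => (p v).ofLp) σ τ n)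
    (hc : ConstantOn (fun v => (p v).ofLp) (σ ∩ τ) n) {x y : V → ℝ}
    (hx0 : ∀ v, 0 ≤ x v) (hx1 : ∑ v, x v = 1) (hxσ : ∀ v ∉ σ, x v = 0)
    (hy0 : ∀ v, 0 ≤ y v) (hy1 : ∑ v, y v = 1) (hyτ : ∀ v ∉ τ, y v = 0)
    (hxy : ∑ v, x v • p v = ∑ v, y v • p v) : ∀ v, (v ∉ τ → x v = 0) ∧ (v ∉ σ → y v = 0) := by
  set l : V → ℝ := fun v => dot n (p v).ofLp with hl
  have hsum : ∑ v, ∑ u, x v * y u * (l u - l v) = 0 := by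
    have h := congrArg (fun q : E3 => dot n q.ofLp) hxy
    simp only [dot_realizationMap] at h
    calc ∑ v, ∑ u, x v * y u * (l u - l v)
        = ∑ v, (x v * ∑ u, y u * l u - x v * l v * ∑ u, y u) := by
          refine Finset.sum_congr rfl fun v _ => ?_
          rw [Finset.mul_sum, Finset.mul_sum, ← Finset.sum_sub_distrib]
          exact Finset.sum_congr rfl fun u _ => by ring
      _ = 0 := by
          rw [Finset.sum_sub_distrib, ← Finset.sum_mul, ← Finset.sum_mul, hx1, hy1, ← h]
          ring
  have hnn : ∀ v u, 0 ≤ x v * y u * (l u - l v) := by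
    intro v u
    by_cases hv : v ∈ σ
    swap
    · simp [hxσ v hv]
    by_cases hu : u ∈ τ
    swap
    · simp [hyτ u hu]
    refine mul_nonneg (mul_nonneg (hx0 v) (hy0 u)) (sub_nonneg.2 ?_)
    by_cases h : v ∉ τ ∨ u ∉ σ
    · exact (hs v hv u hu h).le
    · push Not at h
      exact (hc v (by simp [hv, h.1]) u (by simp [hu, h.2])).le
  have hzero : ∀ v u, x v * y u * (l u - l v) = 0 := by
    have h1 := (Finset.sum_eq_zero_iff_of_nonneg
      (fun v _ => Finset.sum_nonneg fun u _ => hnn v u)).1 hsum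
    exact fun v u => (Finset.sum_eq_zero_iff_of_nonneg (fun u _ => hnn v u)).1
      (h1 v (Finset.mem_univ v)) u (Finset.mem_univ u)
  have hmul : ∀ v u, (v ∉ τ ∨ u ∉ σ) → x v * y u = 0 := by
    intro v u h
    by_cases hv : v ∈ σ
    swap
    · simp [hxσ v hv]
    by_cases hu : u ∈ τ
    swap
    · simp [hyτ u hu]
    exact (mul_eq_zero.1 (hzero v u)).resolve_right (sub_pos.2 (hs v hv u hu h)).ne'
  have hex : ∀ z : V → ℝ, ∑ v, z v = 1 → ∃ v, z v ≠ 0 := by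
    intro z hz
    by_contra h
    push Not at h
    simp [h] at hz
  intro v
  constructor
  · intro hv
    obtain ⟨u, hu⟩ := hex y hy1
    exact (mul_eq_zero.1 (hmul v u (Or.inl hv))).resolve_right hu
  · intro hv
    obtain ⟨u, hu⟩ := hex x hx1
    exact (mul_eq_zero.1 (hmul u v (Or.inr hv))).resolve_left hu

/-- A realization is injective if any two facets are separated off their common face. The
nondegeneracy of a single facet `σ` is not assumed: it follows from the planes that separate `σ`
from its neighbours across its edges. -/
lemma injective_realizationMap_of_separatedBy {F : Finset (Finset V)} {p : V → E3}
    (hF : ∀ σ ∈ F, ∀ w ∈ σ, ∃ τ ∈ F, σ ≠ τ ∧ σ \ τ = {w} ∧ (σ ∩ τ).Nonempty)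
    (hsep : ∀ σ ∈ F, ∀ τ ∈ F, σ ≠ τ → ∃ n, SeparatedBy (fun v => (p v).ofLp) σ τ n ∧
      ConstantOn (fun v => (p v).ofLp) (σ ∩ τ) n) :
    Function.Injective (realizationMap (complexOfFacets F) p) := by
  have hsame : ∀ σ ∈ F, ∀ x y : V → ℝ, ∑ v, x v = 1 → ∑ v, y v = 1 → (∀ v ∉ σ, x v = 0) →
      (∀ v ∉ σ, y v = 0) → ∑ v, x v • p v = ∑ v, y v • p v → x = y := by
    intro σ hσ x y hx1 hy1 hx hy hxy
    ext w
    by_cases hw : w ∈ σ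
    swap
    · rw [hx w hw, hy w hw]
    obtain ⟨τ, hτ, hne, hdiff, u, hu⟩ := hF σ hσ w hw
    obtain ⟨n, hs, hc⟩ := hsep σ hσ τ hτ hne
    rw [Finset.mem_inter] at hu
    have hwτ : w ∉ τ := by
      have : w ∈ σ \ τ := by simp [hdiff]
      exact (Finset.mem_sdiff.1 this).2
    have hlt := hs w hw u hu.2 (Or.inl hwτ)
    have h := congrArg (fun q : E3 => dot n q.ofLp) hxy
    simp only [dot_realizationMap] at h
    -- The functional minus its value on the common edge only sees the coordinate of `w`.
    have key : ∑ v, (x v - y v) * (dot n (p v).ofLp - dot n (p u).ofLp) =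
        (x w - y w) * (dot n (p w).ofLp - dot n (p u).ofLp) := by
      refine Finset.sum_eq_single w (fun v _ hvw => ?_) (by simp)
      by_cases hv : v ∈ σ
      · have hvτ : v ∈ τ := by
          by_contra hvτ
          have : v ∈ σ \ τ := by simp [hv, hvτ]
          rw [hdiff, Finset.mem_singleton] at this
          exact hvw this
        rw [hc v (by simp [hv, hvτ]) u (by simp [hu]), sub_self, mul_zero]
      · rw [hx v hv, hy v hv, sub_self, zero_mul]
    have key0 : ∑ v, (x v - y v) * (dot n (p v).ofLp - dot n (p u).ofLp) = 0 := by
      simp only [mul_sub, sub_mul, Finset.sum_sub_distrib, ← Finset.sum_mul, hx1, hy1, h]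
      ring
    have := (mul_eq_zero.1 (key.symm.trans key0)).resolve_right (sub_neg.2 hlt).ne
    linarith
  rintro ⟨x, hx⟩ ⟨y, hy⟩ hxy
  obtain ⟨hx0, hx1, σ, hσ, hxσ⟩ := mem_geometricRealization_complexOfFacets.1 hx
  obtain ⟨hy0, hy1, τ, hτ, hyτ⟩ := mem_geometricRealization_complexOfFacets.1 hy
  have hxy' : ∑ v, x v • p v = ∑ v, y v • p v := hxy
  refine Subtype.ext (hsame σ hσ x y hx1 hy1 hxσ ?_ hxy')
  by_cases hst : σ = τ
  · rwa [hst]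
  · obtain ⟨n, hs, hc⟩ := hsep σ hσ τ hτ hst
    exact fun v hv => (eq_zero_of_separatedBy hs hc hx0 hx1 hxσ hy0 hy1 hyτ hxy' v).2 hv


end Complex

/-! ### Stability of separating planes -/

section Stability

variable {V : Type*}


lemma eventually_separatedBy {q₀ : V → Fin 3 → ℝ} {σ τ : Finset V}
    {n : (V → Fin 3 → ℝ) → Fin 3 → ℝ} (hn : Continuous n) (h : SeparatedBy q₀ σ τ (n q₀)) :
    ∀ᶠ q in 𝓝 q₀, SeparatedBy q σ τ (n q) := by
  simp only [SeparatedBy, Filter.eventually_all_finset, Filter.eventually_all]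
  intro v hv u hu huv
  have hcont : ∀ w : V, Continuous fun q : V → Fin 3 → ℝ => dot (n q) (q w) := by
    intro w
    unfold dot
    fun_prop
  exact (hcont v).continuousAt.eventually_lt (hcont u).continuousAt (h v hv u hu huv)

lemma constantOn_of_card_le_one {R : Type*} [CommRing R] (q : V → Fin 3 → R) {σ : Finset V}
    (h : σ.card ≤ 1) (n : Fin 3 → R) : ConstantOn q σ n := by
  intro v hv u hu
  rw [Finset.card_le_one.1 h v hv u hu]

/-- A vector orthogonal to the edge from `q u` to `q v`, the cross product of that edge with `w`. -/
def edgeNormal {R : Type*} [CommRing R] (u v : V) (w : Fin 3 → R) (q : V → Fin 3 → R) :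
    Fin 3 → R :=
  ![(q v 1 - q u 1) * w 2 - (q v 2 - q u 2) * w 1,
    (q v 2 - q u 2) * w 0 - (q v 0 - q u 0) * w 2,
    (q v 0 - q u 0) * w 1 - (q v 1 - q u 1) * w 0]

lemma constantOn_edgeNormal [DecidableEq V] {R : Type*} [CommRing R] (q : V → Fin 3 → R) {σ : Finset V}
    {u v : V} (h : σ ⊆ {u, v}) (w : Fin 3 → R) : ConstantOn q σ (edgeNormal u v w q) := by
  have huv : dot (edgeNormal u v w q) (q u) = dot (edgeNormal u v w q) (q v) := by
    simp only [dot, edgeNormal, Matrix.cons_val]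
    ring
  intro a ha b hb
  have ha := h ha
  have hb := h hb
  simp only [Finset.mem_insert, Finset.mem_singleton] at ha hb
  rcases ha with rfl | rfl <;> rcases hb with rfl | rfl <;> simp [huv]

lemma continuous_edgeNormal (u v : V) (w : Fin 3 → ℝ) : Continuous (edgeNormal u v w) := by
  refine continuous_pi fun i => ?_
  fin_cases i <;> simp only [edgeNormal] <;> fun_prop

end Stability

/-! ### Placements near the special realization are embedded -/

/-- The facets of the subdivided bipyramid. -/
def subdividedFacets : Finset (Finset Vertex) :=
  {{T, v1, v2}, {T, v2, v3}, {T, v3, v4}, {T, v4, v5}, {T, v5, v1},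
   {B, v2, v3}, {B, v3, v4}, {B, v4, v5}, {B, v5, v1}, {N, B, v1}, {N, v1, v2}, {N, B, v2}}

lemma subdividedBipyramid_eq : subdividedBipyramid = complexOfFacets subdividedFacets := by
  have : bipyramidFacets.erase {B, v1, v2} ∪ {{N, B, v1}, {N, v1, v2}, {N, B, v2}} =
      subdividedFacets := by decide +kernel
  rw [subdividedBipyramid, this]

/-- The special realization scaled by `610540`, the common denominator of its coordinates. -/
def scaledPosition : Vertex → Fin 3 → ℤ
  | T => ![0, 0, 610540]
  | B => ![0, 0, -610540]
  | v1 => ![1308300, -1678985, -1526350]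
  | v2 => ![-1113700, 794185, 1526350]
  | v3 => ![1308300, 1678985, 1526350]
  | v4 => ![1201900, 653065, 1526350]
  | v5 => ![-2082500, -440265, -1526350]
  | N => ![-3247902, -612983, -2342860]

lemma specialRealization_apply (v : Vertex) (i : Fin 3) :
    (specialRealization v).ofLp i = (scaledPosition v i : ℝ) / 610540 := by
  cases v <;> fin_cases i <;>
    simp [specialRealization, nelsonPosition, newVertex, cross, reflection₁, reflection₂,
      scaledPosition, crossProduct] <;>
    norm_num

/-- Normal vectors that suffice to separate all pairs of facets sharing at most one vertex. -/
def separatingNormals : List (Fin 3 → ℤ) :=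
  [![-3, -2, -1], ![-1, -3, 2], ![-1, 11, -3], ![-3, 1, 3], ![-1, -3, 1], ![-4, -11, 6],
   ![-1, 0, 2], ![-1, 2, -2], ![-2, 1, 1], ![-1, -6, 4], ![-2, -5, 5]]

/-- Vectors whose cross products with the edges separate all pairs of adjacent facets. -/
def separatingDirections : List (Fin 3 → ℤ) :=
  [![-2, 0, -1], ![-1, -1, -1], ![-1, 0, -1], ![-3, 0, -1]]

instance {V : Type*} [DecidableEq V] (q : V → Fin 3 → ℤ) (σ τ : Finset V) (n : Fin 3 → ℤ) :
    Decidable (SeparatedBy q σ τ n) := by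
  unfold SeparatedBy
  infer_instance

lemma exists_separating_scaledPosition : ∀ σ ∈ subdividedFacets, ∀ τ ∈ subdividedFacets, σ ≠ τ →
    ((σ ∩ τ).card ≤ 1 ∧ ∃ n ∈ separatingNormals,
      SeparatedBy scaledPosition σ τ n ∨ SeparatedBy scaledPosition τ σ n) ∨
    ∃ u v, σ ∩ τ ⊆ {u, v} ∧ ∃ w ∈ separatingDirections,
      SeparatedBy scaledPosition σ τ (edgeNormal u v w scaledPosition) ∨
      SeparatedBy scaledPosition τ σ (edgeNormal u v w scaledPosition) := by
  decide +kernel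

lemma exists_neighbour_subdividedFacets : ∀ σ ∈ subdividedFacets, ∀ w ∈ σ, ∃ τ ∈ subdividedFacets,
    σ ≠ τ ∧ σ \ τ = {w} ∧ (σ ∩ τ).Nonempty := by
  decide +kernel
/-- The coordinate functions of the special realization. -/
def specialCoord (v : Vertex) (i : Fin 3) : ℝ := (scaledPosition v i : ℝ) / 610540

lemma specialCoord_eq : (fun v => (specialRealization v).ofLp) = specialCoord := by
  ext v i
  exact specialRealization_apply v i

lemma SeparatedBy.cast_specialCoord {σ τ : Finset Vertex} {n : Fin 3 → ℤ}
    (h : SeparatedBy scaledPosition σ τ n) :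
    SeparatedBy specialCoord σ τ fun i => (n i : ℝ) := by
  intro v hv u hu huv
  have hcast : ∀ w, dot (fun i => (n i : ℝ)) (specialCoord w) =
      (dot n (scaledPosition w) : ℤ) / 610540 := by
    intro w
    simp only [dot, specialCoord]
    push_cast
    ring
  rw [hcast, hcast]
  have : ((dot n (scaledPosition v) : ℤ) : ℝ) < (dot n (scaledPosition u) : ℤ) := by
    exact_mod_cast h v hv u hu huv
  gcongr

lemma SeparatedBy.cast_edgeNormal_specialCoord {σ τ : Finset Vertex} {a b : Vertex}
    {w : Fin 3 → ℤ} (h : SeparatedBy scaledPosition σ τ (edgeNormal a b w scaledPosition)) :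
    SeparatedBy specialCoord σ τ (edgeNormal a b (fun i => (w i : ℝ)) specialCoord) := by
  have hcast : edgeNormal a b (fun i => (w i : ℝ)) specialCoord =
      fun i => ((edgeNormal a b w scaledPosition i : ℤ) : ℝ) / 610540 := by
    ext i
    fin_cases i <;> simp [edgeNormal, specialCoord] <;> ring
  intro v hv u hu huv
  have := h.cast_specialCoord v hv u hu huv
  rw [hcast]
  simp only [dot] at this ⊢
  linarith

/-- The separating planes of the special realization move continuously with the vertices, so that
they still separate the facets of every nearby placement. -/
lemma eventually_injective_realizationMap :
    ∀ᶠ p in 𝓝 specialRealization, Function.Injective (realizationMap subdividedBipyramid p) := by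
  have hev : ∀ᶠ q in 𝓝 specialCoord, ∀ σ ∈ subdividedFacets, ∀ τ ∈ subdividedFacets, σ ≠ τ →
      ∃ n, SeparatedBy q σ τ n ∧ ConstantOn q (σ ∩ τ) n := by
    simp only [Filter.eventually_all_finset, Filter.eventually_all]
    intro σ hσ τ hτ hne
    have hneg : ∀ q : Vertex → Fin 3 → ℝ, (∃ n, SeparatedBy q τ σ n ∧ ConstantOn q (σ ∩ τ) n) →
        ∃ n, SeparatedBy q σ τ n ∧ ConstantOn q (σ ∩ τ) n := by
      rintro q ⟨n, hs, hc⟩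
      refine ⟨-n, fun v hv u hu huv => ?_, fun v hv u hu => ?_⟩
      · rw [dot_neg_left, dot_neg_left]
        exact neg_lt_neg (hs u hu v hv huv.symm)
      · rw [dot_neg_left, dot_neg_left, hc v hv u hu]
    rcases exists_separating_scaledPosition σ hσ τ hτ hne with
      ⟨hcard, n, -, h | h⟩ | ⟨a, b, hab, w, -, h | h⟩
    · filter_upwards [eventually_separatedBy continuous_const h.cast_specialCoord] with q hq
      exact ⟨_, hq, constantOn_of_card_le_one q hcard _⟩
    · filter_upwards [eventually_separatedBy continuous_const h.cast_specialCoord] with q hq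
      exact hneg q ⟨_, hq, constantOn_of_card_le_one q hcard _⟩
    · filter_upwards [eventually_separatedBy (continuous_edgeNormal a b _)
        h.cast_edgeNormal_specialCoord] with q hq
      exact ⟨_, hq, constantOn_edgeNormal q hab _⟩
    · filter_upwards [eventually_separatedBy (continuous_edgeNormal a b _)
        h.cast_edgeNormal_specialCoord] with q hq
      exact hneg q ⟨_, hq, constantOn_edgeNormal q hab _⟩
  have hcont : Continuous fun (p : Vertex → E3) (v : Vertex) => (p v).ofLp := by fun_prop
  have htend := hcont.tendsto specialRealization
  rw [specialCoord_eq] at htend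
  filter_upwards [htend.eventually hev] with p hp
  rw [subdividedBipyramid_eq]
  exact injective_realizationMap_of_separatedBy exists_neighbour_subdividedFacets hp

/-! ### The subdivided bipyramid is a sphere -/

/-- A complete simplicial fan with the combinatorics of the subdivided bipyramid: the generators of
its rays. -/
def fanRay : Vertex → E3
  | T => !₂[0, 0, 1]
  | B => !₂[0, 0, -1]
  | v1 => !₂[1, 0, 0]
  | v2 => !₂[0, 1, 0]
  | v3 => !₂[-1, 1, 0]
  | v4 => !₂[-1, 0, 0]
  | v5 => !₂[0, -1, 0]
  | N => !₂[1, 1, -1]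

/-- The coefficients of a vector with respect to the generators of the cone of the fan that contains
it, as piecewise linear functions. -/
def fanCoord (x y z : ℝ) : Vertex → ℝ
  | T => max (z) 0
  | B => max (-z) 0 - max 0 (min (min x y) (-z))
  | v1 => max x 0 - max 0 (min (min x y) (-z))
  | v2 => max 0 (min y (x + y)) - max 0 (min (min x y) (-z))
  | v3 => max 0 (min (-x) y)
  | v4 => max 0 (min (-x) (-x - y))
  | v5 => max 0 (-y)
  | N => max 0 (min (min x y) (-z))

lemma continuous_fanCoord : Continuous fun d : E3 => fanCoord (d 0) (d 1) (d 2) := by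
  refine continuous_pi fun v => ?_
  cases v <;> simp only [fanCoord] <;> fun_prop

lemma sum_vertex {M : Type*} [AddCommMonoid M] (x : Vertex → M) :
    ∑ v, x v = x T + x B + x v1 + x v2 + x v3 + x v4 + x v5 + x N := by
  have : (Finset.univ : Finset Vertex) = {T, B, v1, v2, v3, v4, v5, N} := rfl
  rw [this]
  simp [add_assoc]

lemma sum_smul_fanRay (x : Vertex → ℝ) : ∑ v, x v • fanRay v =
    !₂[x v1 - x v3 - x v4 + x N, x v2 + x v3 - x v5 + x N, x T - x B - x N] := by
  rw [sum_vertex]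
  ext i
  fin_cases i <;> simp [fanRay, Matrix.cons_val] <;> ring

lemma sum_fanCoord_smul_fanRay (d : E3) : ∑ v, fanCoord (d 0) (d 1) (d 2) v • fanRay v = d := by
  rw [sum_smul_fanRay]
  ext i
  fin_cases i <;> simp [fanCoord, Matrix.cons_val] <;> grind

lemma fanCoord_nonneg (x y z : ℝ) (v : Vertex) : 0 ≤ fanCoord x y z v := by
  cases v <;> simp only [fanCoord] <;> grind

lemma fanCoord_smul {r : ℝ} (hr : 0 ≤ r) (x y z : ℝ) :
    fanCoord (r * x) (r * y) (r * z) = r • fanCoord x y z := by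
  ext v
  cases v <;> simp [fanCoord, mul_max_of_nonneg, mul_min_of_nonneg, hr, mul_sub, mul_add]

/-- The cones of the fan cover space. -/
lemma exists_facet_fanCoord (x y z : ℝ) :
    ∃ σ ∈ subdividedFacets, ∀ v ∉ σ, fanCoord x y z v = 0 := by
  have hmem : ∀ σ ∈ subdividedFacets, (∀ v ∉ σ, fanCoord x y z v = 0) →
      ∃ σ ∈ subdividedFacets, ∀ v ∉ σ, fanCoord x y z v = 0 := fun σ hσ h => ⟨σ, hσ, h⟩
  rcases le_total 0 x with hx | hx <;> rcases le_total 0 y with hy | hy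
  · rcases le_total 0 z with hz | hz
    · refine hmem {T, v1, v2} (by decide +kernel) fun v hv => ?_
      cases v <;> simp at hv <;> simp only [fanCoord] <;> grind
    · by_cases h1 : x ≤ y ∧ x ≤ -z
      · refine hmem {N, B, v2} (by decide +kernel) fun v hv => ?_
        cases v <;> simp at hv <;> simp only [fanCoord] <;> grind
      · by_cases h2 : y ≤ -z
        · refine hmem {N, B, v1} (by decide +kernel) fun v hv => ?_
          cases v <;> simp at hv <;> simp only [fanCoord] <;> grind
        · refine hmem {N, v1, v2} (by decide +kernel) fun v hv => ?_
          cases v <;> simp at hv <;> simp only [fanCoord] <;> grind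
  · rcases le_total 0 z with hz | hz
    · refine hmem {T, v5, v1} (by decide +kernel) fun v hv => ?_
      cases v <;> simp at hv <;> simp only [fanCoord] <;> grind
    · refine hmem {B, v5, v1} (by decide +kernel) fun v hv => ?_
      cases v <;> simp at hv <;> simp only [fanCoord] <;> grind
  · rcases le_total 0 z with hz | hz <;> rcases le_total 0 (x + y) with hs | hs
    · refine hmem {T, v2, v3} (by decide +kernel) fun v hv => ?_
      cases v <;> simp at hv <;> simp only [fanCoord] <;> grind
    · refine hmem {T, v3, v4} (by decide +kernel) fun v hv => ?_
      cases v <;> simp at hv <;> simp only [fanCoord] <;> grind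
    · refine hmem {B, v2, v3} (by decide +kernel) fun v hv => ?_
      cases v <;> simp at hv <;> simp only [fanCoord] <;> grind
    · refine hmem {B, v3, v4} (by decide +kernel) fun v hv => ?_
      cases v <;> simp at hv <;> simp only [fanCoord] <;> grind
  · rcases le_total 0 z with hz | hz
    · refine hmem {T, v4, v5} (by decide +kernel) fun v hv => ?_
      cases v <;> simp at hv <;> simp only [fanCoord] <;> grind
    · refine hmem {B, v4, v5} (by decide +kernel) fun v hv => ?_
      cases v <;> simp at hv <;> simp only [fanCoord] <;> grind

/-- The coordinate functions recover the coefficients of a nonnegative combination of the generators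
of a cone. -/
lemma fanCoord_eq_of_mem_cone {x : Vertex → ℝ} (h0 : ∀ v, 0 ≤ x v) {σ : Finset Vertex}
    (hσ : σ ∈ subdividedFacets) (hx : ∀ v ∉ σ, x v = 0) :
    fanCoord (x v1 - x v3 - x v4 + x N) (x v2 + x v3 - x v5 + x N) (x T - x B - x N) = x := by
  have hT := h0 T
  have hB := h0 B
  have h1 := h0 v1
  have h2 := h0 v2
  have h3 := h0 v3
  have h4 := h0 v4
  have h5 := h0 v5
  have hN := h0 N
  -- The coordinates of two vertices that do not span an edge cannot both be nonzero, and neither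
  -- can those of `B`, `v1` and `v2`.
  have hne : ∀ a b : Vertex, (∀ σ ∈ subdividedFacets, a ∉ σ ∨ b ∉ σ) → x a = 0 ∨ x b = 0 :=
    fun a b h => (h σ hσ).imp (hx a) (hx b)
  have hTB := hne T B (by decide +kernel)
  have hTN := hne T N (by decide +kernel)
  have h13 := hne v1 v3 (by decide +kernel)
  have h14 := hne v1 v4 (by decide +kernel)
  have h24 := hne v2 v4 (by decide +kernel)
  have h25 := hne v2 v5 (by decide +kernel)
  have h35 := hne v3 v5 (by decide +kernel)
  have hN3 := hne N v3 (by decide +kernel)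
  have hN4 := hne N v4 (by decide +kernel)
  have hN5 := hne N v5 (by decide +kernel)
  have hB12 : x B = 0 ∨ x v1 = 0 ∨ x v2 = 0 := by
    have h : ∀ σ ∈ subdividedFacets, B ∉ σ ∨ v1 ∉ σ ∨ v2 ∉ σ := by decide +kernel
    exact (h σ hσ).imp (hx _) (Or.imp (hx _) (hx _))
  have hmin : max 0 (min (min (x v1 - x v3 - x v4 + x N) (x v2 + x v3 - x v5 + x N))
      (-(x T - x B - x N))) = x N := by
    clear hne hx h0 hσ
    grind
  ext v
  clear hne hx h0 hσ
  cases v <;> simp only [fanCoord, hmin] <;> clear hmin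
  all_goals grind

/-- The piecewise linear coordinates of a vector with respect to the fan. -/
def fanWeight (d : E3) : Vertex → ℝ := fanCoord (d 0) (d 1) (d 2)

lemma fanWeight_smul {r : ℝ} (hr : 0 ≤ r) (d : E3) : fanWeight (r • d) = r • fanWeight d :=
  fanCoord_smul hr (d 0) (d 1) (d 2)

lemma fanWeight_sum_smul_fanRay {x : Vertex → ℝ}
    (hx : x ∈ geometricRealization (complexOfFacets subdividedFacets)) :
    fanWeight (∑ v, x v • fanRay v) = x := by
  obtain ⟨h0, -, σ, hσ, hx⟩ := mem_geometricRealization_complexOfFacets.1 hx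
  rw [sum_smul_fanRay]
  exact fanCoord_eq_of_mem_cone h0 hσ hx

lemma sum_fanWeight_pos {d : E3} (hd : d ≠ 0) : 0 < ∑ v, fanWeight d v := by
  refine (Finset.sum_nonneg fun v _ => fanCoord_nonneg _ _ _ v).lt_of_ne fun h => hd ?_
  have h0 := (Finset.sum_eq_zero_iff_of_nonneg fun v _ => fanCoord_nonneg _ _ _ v).1 h.symm
  rw [← sum_fanCoord_smul_fanRay d]
  exact Finset.sum_eq_zero fun v hv => by rw [h0 v hv, zero_smul]

lemma sum_smul_fanRay_ne_zero {x : Vertex → ℝ}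
    (hx : x ∈ geometricRealization (complexOfFacets subdividedFacets)) :
    ∑ v, x v • fanRay v ≠ 0 := by
  intro h
  have h1 := fanWeight_sum_smul_fanRay hx
  have h2 := (mem_geometricRealization_complexOfFacets.1 hx).2.1
  rw [h, ← zero_smul ℝ (0 : E3), fanWeight_smul le_rfl, zero_smul] at h1
  simp [← h1] at h2

/-- Radial projection of the simplicial sphere spanned by the rays of the fan. -/
def geometricRealizationHomeomorphSphere :
    geometricRealization (complexOfFacets subdividedFacets) ≃ₜ Metric.sphere (0 : E3) 1 where
  toFun x := ⟨‖∑ v, x.1 v • fanRay v‖⁻¹ • ∑ v, x.1 v • fanRay v, by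
    simp [norm_smul, norm_ne_zero_iff.2 (sum_smul_fanRay_ne_zero x.2)]⟩
  invFun d := ⟨(∑ v, fanWeight d.1 v)⁻¹ • fanWeight d.1, by
    have hd : d.1 ≠ 0 := ne_zero_of_mem_unit_sphere d
    have hpos := sum_fanWeight_pos hd
    obtain ⟨σ, hσ, h⟩ := exists_facet_fanCoord (d.1 0) (d.1 1) (d.1 2)
    refine mem_geometricRealization_complexOfFacets.2 ⟨fun v => ?_, ?_, σ, hσ, fun v hv => ?_⟩
    · exact mul_nonneg (inv_nonneg.2 hpos.le) (fanCoord_nonneg _ _ _ v)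
    · simp only [Pi.smul_apply, smul_eq_mul, ← Finset.mul_sum]
      exact inv_mul_cancel₀ hpos.ne'
    · simp only [Pi.smul_apply, fanWeight, h v hv, smul_zero]⟩
  left_inv := by
    rintro ⟨x, hx⟩
    have hne := norm_ne_zero_iff.2 (sum_smul_fanRay_ne_zero hx)
    have h1 := (mem_geometricRealization_complexOfFacets.1 hx).2.1
    refine Subtype.ext ?_
    simp only [fanWeight_smul (inv_nonneg.2 (norm_nonneg _)), fanWeight_sum_smul_fanRay hx,
      Pi.smul_apply, smul_eq_mul, ← Finset.mul_sum, h1, mul_one, smul_smul]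
    rw [inv_mul_cancel₀ (inv_ne_zero hne), one_smul]
  right_inv := by
    rintro ⟨d, hd⟩
    have hd0 : d ≠ 0 := ne_zero_of_mem_unit_sphere ⟨d, hd⟩
    have hpos := sum_fanWeight_pos hd0
    have hnorm : ‖d‖ = 1 := by simpa using hd
    have hsum : ∑ v, fanWeight d v • fanRay v = d := sum_fanCoord_smul_fanRay d
    refine Subtype.ext ?_
    simp only [Pi.smul_apply, smul_eq_mul, mul_smul, ← Finset.smul_sum, hsum, norm_smul, hnorm,
      norm_inv, Real.norm_of_nonneg hpos.le, mul_one, inv_inv]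
    rw [smul_inv_smul₀ hpos.ne']
  continuous_toFun := by
    refine Continuous.subtype_mk ?_ _
    have h : Continuous fun x : geometricRealization (complexOfFacets subdividedFacets) =>
        ∑ v, x.1 v • fanRay v :=
      continuous_finsetSum _ fun v _ =>
        ((continuous_apply v).comp continuous_subtype_val).smul continuous_const
    exact (h.norm.inv₀ fun x => norm_ne_zero_iff.2 (sum_smul_fanRay_ne_zero x.2)).smul h
  continuous_invFun := by
    refine Continuous.subtype_mk ?_ _
    have h : Continuous fun d : Metric.sphere (0 : E3) 1 => fanWeight d.1 :=
      continuous_fanCoord.comp continuous_subtype_val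
    have hs : Continuous fun d : Metric.sphere (0 : E3) 1 => ∑ v, fanWeight d.1 v :=
      continuous_finsetSum _ fun v _ => (continuous_apply v).comp h
    exact (hs.inv₀ fun d => (sum_fanWeight_pos (ne_zero_of_mem_unit_sphere d)).ne').smul h

lemma isEmbeddedPolyhedron_of_injective {p : Vertex → E3}
    (h : Function.Injective (realizationMap subdividedBipyramid p)) :
    IsEmbeddedPolyhedron subdividedBipyramid p := by
  refine ⟨?_, h⟩
  rw [subdividedBipyramid_eq]
  exact ⟨geometricRealizationHomeomorphSphere⟩

/-! ### Edge lengths in the Nelson construction -/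

lemma dist_sq_eq (p q : E3) :
    dist p q ^ 2 = (p 0 - q 0) ^ 2 + (p 1 - q 1) ^ 2 + (p 2 - q 2) ^ 2 := by
  rw [EuclideanSpace.dist_eq, Real.sq_sqrt (Finset.sum_nonneg fun i _ => sq_nonneg _),
    Fin.sum_univ_three]
  simp only [Real.dist_eq, sq_abs]

/-- Stewart's theorem. -/
lemma dist_sq_combination (μ : ℝ) (p q r : E3) :
    dist r (μ • p + (1 - μ) • q) ^ 2 =
      μ * dist p r ^ 2 + (1 - μ) * dist q r ^ 2 - μ * (1 - μ) * dist p q ^ 2 := by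
  simp only [dist_sq_eq, PiLp.add_apply, PiLp.smul_apply, smul_eq_mul]
  ring

lemma reflection₁_reflection₁ (p : E3) : reflection₁ (reflection₁ p) = p := by
  ext i
  fin_cases i <;> simp [reflection₁]

lemma dist_reflection₁ (p q : E3) : dist (reflection₁ p) (reflection₁ q) = dist p q := by
  rw [← sq_eq_sq₀ dist_nonneg dist_nonneg, dist_sq_eq, dist_sq_eq]
  simp [reflection₁]
  ring

lemma reflection₂_reflection₂ (t : ℝ) (p : E3) : reflection₂ t (reflection₂ t p) = p := by
  have h : t ^ 2 + 1 ≠ 0 := by positivity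
  ext i
  fin_cases i <;> simp [reflection₂] <;> field_simp <;> ring

lemma dist_reflection₂ (t : ℝ) (p q : E3) :
    dist (reflection₂ t p) (reflection₂ t q) = dist p q := by
  have h : t ^ 2 + 1 ≠ 0 := by positivity
  rw [← sq_eq_sq₀ dist_nonneg dist_nonneg, dist_sq_eq, dist_sq_eq]
  simp [reflection₂]
  field_simp
  ring

/-- The Gram matrix of the triangle `p₁ p₂ pB` determines the distances from its vertices to the
additional vertex. -/
lemma dist_sq_newVertex (p₁ p₂ pB : E3) :
    let A := dist p₁ p₂ ^ 2
    let D := dist pB p₁ ^ 2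
    let g := (A + D - dist pB p₂ ^ 2) / 2
    dist (newVertex p₁ p₂ pB) p₁ ^ 2 =
        81 / 100 * A - 27 / 5 * g + 9 * D + 9 / 25 * (A * D - g ^ 2) ∧
      dist (newVertex p₁ p₂ pB) p₂ ^ 2 =
        361 / 100 * A - 57 / 5 * g + 9 * D + 9 / 25 * (A * D - g ^ 2) ∧
      dist (newVertex p₁ p₂ pB) pB ^ 2 =
        81 / 100 * A - 18 / 5 * g + 4 * D + 9 / 25 * (A * D - g ^ 2) := by
  simp only [dist_sq_eq]
  simp [newVertex, cross, crossProduct]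
  refine ⟨?_, ?_, ?_⟩ <;> ring

/-- The position of the subdivided bipyramid given by the Nelson construction, with the additional
vertex attached rigidly to the triangle spanned by `v1`, `v2` and `B`. -/
def nelsonRealization (t a x y z μ : ℝ) : Vertex → E3 :=
  let b : Vertex → E3 := nelsonPosition t a x y z μ 0
  nelsonPosition t a x y z μ (newVertex (b v1) (b v2) (b B))

lemma nelsonRealization_special :
    nelsonRealization (-5 / 8) 1 (15 / 7) (11 / 4) (5 / 2) (2 / 7) = specialRealization := rfl

/-- The lengths of the edges in the Nelson construction, in terms of four quantities: the distances
from `v3` to `T` and `B`, the length of `v1 v5`, and a weighted sum of the squares of the distances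
from `v3` to `v1` and `v5`. -/
lemma dist_nelsonPosition (t a x y z μ : ℝ) (n : E3) :
    let p := nelsonPosition t a x y z μ n
    let b := dist (p B) (p v3) ^ 2
    let c := dist (p T) (p v3) ^ 2
    let d := dist (p v5) (p v1) ^ 2
    let e := μ * dist (p v1) (p v3) ^ 2 + (1 - μ) * dist (p v5) (p v3) ^ 2
    dist (p T) (p v1) ^ 2 = b ∧ dist (p T) (p v5) ^ 2 = b ∧
    dist (p B) (p v1) ^ 2 = c ∧ dist (p B) (p v5) ^ 2 = c ∧
    dist (p T) (p v2) ^ 2 = c - μ * (1 - μ) * d ∧ dist (p T) (p v4) ^ 2 = c - μ * (1 - μ) * d ∧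
    dist (p B) (p v2) ^ 2 = b - μ * (1 - μ) * d ∧ dist (p B) (p v4) ^ 2 = b - μ * (1 - μ) * d ∧
    dist (p v1) (p v2) ^ 2 = e - μ * (1 - μ) * d ∧ dist (p v5) (p v4) ^ 2 = e - μ * (1 - μ) * d ∧
    dist (p v3) (p v2) ^ 2 = (1 - μ) ^ 2 * d ∧ dist (p v3) (p v4) ^ 2 = μ ^ 2 * d := by
  intro p b c d e
  have h₁ : ∀ q r, dist (reflection₁ q) r = dist q (reflection₁ r) := fun q r => by
    rw [← dist_reflection₁, reflection₁_reflection₁]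
  have h₂ : ∀ q r, dist (reflection₂ t q) r = dist q (reflection₂ t r) := fun q r => by
    rw [← dist_reflection₂ t, reflection₂_reflection₂]
  have hT₁ : reflection₁ (p T) = p B := by
    ext i; fin_cases i <;> simp [p, nelsonPosition, reflection₁]
  have hB₁ : reflection₁ (p B) = p T := by rw [← hT₁, reflection₁_reflection₁]
  have hT₂ : reflection₂ t (p T) = p B := by
    ext i; fin_cases i <;> simp [p, nelsonPosition, reflection₂]
  have hB₂ : reflection₂ t (p B) = p T := by rw [← hT₂, reflection₂_reflection₂]
  have e1 : p v1 = reflection₁ (p v3) := rfl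
  have e5 : p v5 = reflection₂ t (p v3) := rfl
  have f1 : reflection₁ (p v1) = p v3 := reflection₁_reflection₁ _
  have f5 : reflection₂ t (p v5) = p v3 := reflection₂_reflection₂ _ _
  have e2 : p v2 = reflection₁ (μ • p v1 + (1 - μ) • p v5) := rfl
  have e4 : p v4 = reflection₂ t (μ • p v1 + (1 - μ) • p v5) := rfl
  have hT1 : dist (p T) (p v1) ^ 2 = b := by rw [e1, ← h₁, hT₁]
  have hT5 : dist (p T) (p v5) ^ 2 = b := by rw [e5, ← h₂, hT₂]
  have hB1 : dist (p B) (p v1) ^ 2 = c := by rw [e1, ← h₁, hB₁]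
  have hB5 : dist (p B) (p v5) ^ 2 = c := by rw [e5, ← h₂, hB₂]
  refine ⟨hT1, hT5, hB1, hB5, ?_, ?_, ?_, ?_, ?_, ?_, ?_, ?_⟩
  · rw [e2, ← h₁, hT₁, dist_sq_combination, dist_comm _ (p B), dist_comm _ (p B), hB1, hB5,
      dist_comm]
    ring
  · rw [e4, ← h₂, hT₂, dist_sq_combination, dist_comm _ (p B), dist_comm _ (p B), hB1, hB5,
      dist_comm]
    ring
  · rw [e2, ← h₁, hB₁, dist_sq_combination, dist_comm _ (p T), dist_comm _ (p T), hT1, hT5,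
      dist_comm]
    ring
  · rw [e4, ← h₂, hB₂, dist_sq_combination, dist_comm _ (p T), dist_comm _ (p T), hT1, hT5,
      dist_comm]
    ring
  · rw [e2, ← h₁, f1, dist_sq_combination, dist_comm (p v1) (p v5)]
  · rw [e4, ← h₂, f5, dist_sq_combination, dist_comm (p v1) (p v5)]
  · rw [e2, ← h₁, ← e1, dist_sq_combination, dist_self, dist_comm (p v1) (p v5)]
    ring
  · rw [e4, ← h₂, ← e5, dist_sq_combination, dist_self, dist_comm (p v1) (p v5)]
    ring

/-- The edges of the subdivided bipyramid, each with one orientation. -/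
def subdividedEdges : List (Vertex × Vertex) :=
  [(T, v1), (T, v2), (T, v3), (T, v4), (T, v5), (B, v1), (B, v2), (B, v3), (B, v4), (B, v5),
   (v1, v2), (v3, v2), (v3, v4), (v5, v4), (v5, v1), (N, v1), (N, v2), (N, B)]

lemma mem_subdividedEdges_of_adj {u v : Vertex} (h : (edgeGraph subdividedBipyramid).Adj u v) :
    (u, v) ∈ subdividedEdges ∨ (v, u) ∈ subdividedEdges := by
  rw [subdividedBipyramid_eq] at h
  obtain ⟨hne, -, σ, hσ, hsub⟩ := h
  have key : ∀ σ ∈ subdividedFacets, ∀ u ∈ σ, ∀ v ∈ σ, u ≠ v →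
      (u, v) ∈ subdividedEdges ∨ (v, u) ∈ subdividedEdges := by decide +kernel
  exact key σ hσ u (hsub (by simp)) v (hsub (by simp)) hne

lemma sameEdgeLengths_of_dist_sq {p q : Vertex → E3}
    (h : ∀ u v, (u, v) ∈ subdividedEdges → dist (p u) (p v) ^ 2 = dist (q u) (q v) ^ 2) :
    SameEdgeLengths (edgeGraph subdividedBipyramid) p q := by
  intro u v huv
  rw [← sq_eq_sq₀ dist_nonneg dist_nonneg]
  rcases mem_subdividedEdges_of_adj huv with huv | huv
  · exact h u v huv
  · rw [dist_comm (p u), dist_comm (q u)]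
    exact h v u huv

/-- Two Nelson realizations have the same edge lengths as soon as four quantities agree. -/
lemma sameEdgeLengths_nelsonRealization {t a x y z t' a' x' y' z' μ : ℝ}
    (hB : dist (nelsonRealization t a x y z μ B) (nelsonRealization t a x y z μ v3) ^ 2 =
      dist (nelsonRealization t' a' x' y' z' μ B) (nelsonRealization t' a' x' y' z' μ v3) ^ 2)
    (hT : dist (nelsonRealization t a x y z μ T) (nelsonRealization t a x y z μ v3) ^ 2 =
      dist (nelsonRealization t' a' x' y' z' μ T) (nelsonRealization t' a' x' y' z' μ v3) ^ 2)
    (h5 : dist (nelsonRealization t a x y z μ v5) (nelsonRealization t a x y z μ v1) ^ 2 =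
      dist (nelsonRealization t' a' x' y' z' μ v5) (nelsonRealization t' a' x' y' z' μ v1) ^ 2)
    (hμ : μ * dist (nelsonRealization t a x y z μ v1) (nelsonRealization t a x y z μ v3) ^ 2 +
        (1 - μ) * dist (nelsonRealization t a x y z μ v5) (nelsonRealization t a x y z μ v3) ^ 2 =
      μ * dist (nelsonRealization t' a' x' y' z' μ v1) (nelsonRealization t' a' x' y' z' μ v3) ^ 2 +
        (1 - μ) *
          dist (nelsonRealization t' a' x' y' z' μ v5) (nelsonRealization t' a' x' y' z' μ v3) ^ 2) :
    SameEdgeLengths (edgeGraph subdividedBipyramid) (nelsonRealization t a x y z μ)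
      (nelsonRealization t' a' x' y' z' μ) := by
  have key := dist_nelsonPosition t a x y z μ (nelsonRealization t a x y z μ N)
  have key' := dist_nelsonPosition t' a' x' y' z' μ (nelsonRealization t' a' x' y' z' μ N)
  have hN := dist_sq_newVertex (nelsonRealization t a x y z μ v1) (nelsonRealization t a x y z μ v2)
    (nelsonRealization t a x y z μ B)
  have hN' := dist_sq_newVertex (nelsonRealization t' a' x' y' z' μ v1)
    (nelsonRealization t' a' x' y' z' μ v2) (nelsonRealization t' a' x' y' z' μ B)
  change _ ∧ _ at key key'
  have e : nelsonPosition t a x y z μ (nelsonRealization t a x y z μ N) =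
    nelsonRealization t a x y z μ := rfl
  have e' : nelsonPosition t' a' x' y' z' μ (nelsonRealization t' a' x' y' z' μ N) =
    nelsonRealization t' a' x' y' z' μ := rfl
  have eN : newVertex (nelsonRealization t a x y z μ v1) (nelsonRealization t a x y z μ v2)
    (nelsonRealization t a x y z μ B) = nelsonRealization t a x y z μ N := rfl
  have eN' : newVertex (nelsonRealization t' a' x' y' z' μ v1)
    (nelsonRealization t' a' x' y' z' μ v2) (nelsonRealization t' a' x' y' z' μ B) =
    nelsonRealization t' a' x' y' z' μ N := rfl
  simp only [e, e'] at key key'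
  simp only [eN, eN'] at hN hN'
  generalize nelsonRealization t a x y z μ = p at *
  generalize nelsonRealization t' a' x' y' z' μ = q at *
  obtain ⟨hT1, hT5, hB1, hB5, hT2, hT4, hB2, hB4, h12, h54, h32, h34⟩ := key
  obtain ⟨hT1', hT5', hB1', hB5', hT2', hT4', hB2', hB4', h12', h54', h32', h34'⟩ := key'
  rw [h12, hB1, hB2] at hN
  rw [h12', hB1', hB2'] at hN'
  apply sameEdgeLengths_of_dist_sq
  intro u v huv
  simp only [subdividedEdges, List.mem_cons, List.not_mem_nil, or_false, Prod.mk.injEq] at huv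
  rcases huv with ⟨rfl, rfl⟩ | ⟨rfl, rfl⟩ | ⟨rfl, rfl⟩ | ⟨rfl, rfl⟩ | ⟨rfl, rfl⟩ | ⟨rfl, rfl⟩ |
    ⟨rfl, rfl⟩ | ⟨rfl, rfl⟩ | ⟨rfl, rfl⟩ | ⟨rfl, rfl⟩ | ⟨rfl, rfl⟩ | ⟨rfl, rfl⟩ | ⟨rfl, rfl⟩ |
    ⟨rfl, rfl⟩ | ⟨rfl, rfl⟩ | ⟨rfl, rfl⟩ | ⟨rfl, rfl⟩ | ⟨rfl, rfl⟩
  · rw [hT1, hT1', hB]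
  · rw [hT2, hT2', hT, h5]
  · exact hT
  · rw [hT4, hT4', hT, h5]
  · rw [hT5, hT5', hB]
  · rw [hB1, hB1', hT]
  · rw [hB2, hB2', hB, h5]
  · exact hB
  · rw [hB4, hB4', hB, h5]
  · rw [hB5, hB5', hT]
  · rw [h12, h12', hμ, h5]
  · rw [h32, h32', h5]
  · rw [h34, h34', h5]
  · rw [h54, h54', hμ, h5]
  · exact h5
  · rw [hN.1, hN'.1, hμ, h5, hB, hT]
  · rw [hN.2.1, hN'.2.1, hμ, h5, hB, hT]
  · rw [hN.2.2, hN'.2.2, hμ, h5, hB, hT]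

/-! ### The one-parameter family of Nelson realizations -/

/-- A solution `(x₀, y₀)` of the equations `x² + y² = ρ` and `α (x² - y²) + β (2 x y) = γ` can be
continued when the coefficients vary continuously. In the double-angle coordinates `P = x² - y²`,
`Q = 2 x y`, the equations describe the intersection of a line and a circle, and the last
hypothesis says that the intersection is transverse. -/
lemma exists_continuation_of_transverse {α β γ ρ : ℝ → ℝ} (hα : Continuous α) (hβ : Continuous β)
    (hγ : Continuous γ) (hρ : Continuous ρ) {x₀ y₀ : ℝ} (hx₀ : 0 < x₀)
    (hcirc : x₀ ^ 2 + y₀ ^ 2 = ρ 0)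
    (hline : α 0 * (x₀ ^ 2 - y₀ ^ 2) + β 0 * (2 * x₀ * y₀) = γ 0)
    (htrans : β 0 * (x₀ ^ 2 - y₀ ^ 2) - α 0 * (2 * x₀ * y₀) < 0) :
    ∃ x y : ℝ → ℝ, x 0 = x₀ ∧ y 0 = y₀ ∧ ∀ᶠ s in 𝓝 0, ContinuousAt x s ∧ ContinuousAt y s ∧
      x s ^ 2 + y s ^ 2 = ρ s ∧
      α s * (x s ^ 2 - y s ^ 2) + β s * (2 * x s * y s) = γ s := by
  set N : ℝ → ℝ := fun s => α s ^ 2 + β s ^ 2 with hN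
  set D : ℝ → ℝ := fun s => N s * ρ s ^ 2 - γ s ^ 2 with hD
  set P : ℝ → ℝ := fun s => (α s * γ s - β s * √(D s)) / N s with hP
  set Q : ℝ → ℝ := fun s => (β s * γ s + α s * √(D s)) / N s with hQ
  set x : ℝ → ℝ := fun s => √((ρ s + P s) / 2) with hx
  set y : ℝ → ℝ := fun s => Q s / (2 * x s) with hy
  have hNc : Continuous N := by fun_prop
  have hDc : Continuous D := by fun_prop
  have hPc : ∀ s, N s ≠ 0 → ContinuousAt P s := fun s hs =>
    ((hα.mul hγ).sub (hβ.mul hDc.sqrt)).continuousAt.div hNc.continuousAt hs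
  have hQc : ∀ s, N s ≠ 0 → ContinuousAt Q s := fun s hs =>
    ((hβ.mul hγ).add (hα.mul hDc.sqrt)).continuousAt.div hNc.continuousAt hs
  have hxc : ∀ s, N s ≠ 0 → ContinuousAt x s := fun s hs =>
    ((hρ.continuousAt.add (hPc s hs)).div_const 2).sqrt
  have hN0 : N 0 ≠ 0 := by
    intro h
    have h1 : α 0 = 0 := by simp only [hN] at h; nlinarith [sq_nonneg (α 0), sq_nonneg (β 0)]
    have h2 : β 0 = 0 := by simp only [hN] at h; nlinarith [sq_nonneg (α 0), sq_nonneg (β 0)]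
    simp [h1, h2] at htrans
  have hD0' : D 0 = (-(β 0 * (x₀ ^ 2 - y₀ ^ 2) - α 0 * (2 * x₀ * y₀))) ^ 2 := by
    simp only [hD, hN, ← hcirc, ← hline]
    ring
  have hw0 : √(D 0) = -(β 0 * (x₀ ^ 2 - y₀ ^ 2) - α 0 * (2 * x₀ * y₀)) := by
    rw [hD0', Real.sqrt_sq (by linarith)]
  have hD0 : 0 < D 0 := by
    rw [hD0']
    exact pow_pos (by linarith) 2
  have hP0 : P 0 = x₀ ^ 2 - y₀ ^ 2 := by
    simp only [hP, hw0, ← hline]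
    rw [div_eq_iff hN0]
    simp only [hN]
    ring
  have hQ0 : Q 0 = 2 * x₀ * y₀ := by
    simp only [hQ, hw0, ← hline]
    rw [div_eq_iff hN0]
    simp only [hN]
    ring
  have hρP0 : ρ 0 + P 0 = 2 * x₀ ^ 2 := by
    rw [hP0, ← hcirc]
    ring
  have hx0 : x 0 = x₀ := by
    simp only [hx, hρP0]
    rw [mul_div_cancel_left₀ _ two_ne_zero, Real.sqrt_sq hx₀.le]
  refine ⟨x, y, hx0, ?_, ?_⟩
  · simp only [hy, hQ0, hx0]
    field_simp
  have ev1 : ∀ᶠ s in 𝓝 0, N s ≠ 0 := hNc.continuousAt.eventually_ne hN0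
  have ev2 : ∀ᶠ s in 𝓝 0, 0 < D s := continuousAt_const.eventually_lt hDc.continuousAt hD0
  have ev3 : ∀ᶠ s in 𝓝 0, 0 < ρ s + P s := by
    refine continuousAt_const.eventually_lt (hρ.continuousAt.add (hPc 0 hN0)) ?_
    rw [hρP0]
    positivity
  filter_upwards [ev1, ev2, ev3] with s h1 h2 h3
  have hxs : 0 < x s := Real.sqrt_pos.2 (by linarith)
  have hxsq : x s ^ 2 = (ρ s + P s) / 2 := Real.sq_sqrt (by linarith)
  have hw : √(D s) ^ 2 = N s * ρ s ^ 2 - γ s ^ 2 := Real.sq_sqrt h2.le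
  have hPN : P s * N s = α s * γ s - β s * √(D s) := div_mul_cancel₀ _ h1
  have hQN : Q s * N s = β s * γ s + α s * √(D s) := div_mul_cancel₀ _ h1
  have hNs : N s = α s ^ 2 + β s ^ 2 := rfl
  have hPQ : P s ^ 2 + Q s ^ 2 = ρ s ^ 2 := by
    refine mul_right_cancel₀ (pow_ne_zero 2 h1) ?_
    linear_combination (P s * N s + (α s * γ s - β s * √(D s))) * hPN +
      (Q s * N s + (β s * γ s + α s * √(D s))) * hQN + (α s ^ 2 + β s ^ 2) * hw -
      N s * ρ s ^ 2 * hNs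
  have hxy : 2 * x s * y s = Q s := mul_div_cancel₀ _ (by positivity)
  have hysq : y s ^ 2 = (ρ s - P s) / 2 := by
    refine mul_left_cancel₀ (pow_ne_zero 2 (mul_pos two_pos hxs).ne') ?_
    calc (2 * x s) ^ 2 * y s ^ 2 = (2 * x s * y s) ^ 2 := by ring
      _ = 4 * ((ρ s + P s) / 2) * ((ρ s - P s) / 2) := by rw [hxy]; linear_combination hPQ
      _ = (2 * x s) ^ 2 * ((ρ s - P s) / 2) := by rw [← hxsq]; ring
  refine ⟨hxc s h1, (hQc s h1).div (continuousAt_const.mul (hxc s h1)) (by positivity), ?_, ?_⟩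
  · rw [hxsq, hysq]
    ring
  · rw [hxy, hxsq, hysq]
    refine mul_right_cancel₀ h1 ?_
    linear_combination α s * hPN + β s * hQN - γ s * hNs

/-- The squared distances preserved by the family, as polynomials in the parameters. -/
lemma dist_sq_nelsonRealization (t a x y z μ : ℝ) :
    let p := nelsonRealization t a x y z μ
    dist (p B) (p v3) ^ 2 = x ^ 2 + y ^ 2 + (z ^ 2 + a ^ 2) + 2 * (a * z) ∧
    dist (p T) (p v3) ^ 2 = x ^ 2 + y ^ 2 + (z ^ 2 + a ^ 2) - 2 * (a * z) ∧
    dist (p v5) (p v1) ^ 2 = 4 * ((x ^ 2 + y ^ 2) / (t ^ 2 + 1)) ∧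
    μ * dist (p v1) (p v3) ^ 2 + (1 - μ) * dist (p v5) (p v3) ^ 2 =
      4 * (z ^ 2 + (μ * y ^ 2 * (t ^ 2 + 1) + (1 - μ) * (x - t * y) ^ 2) / (t ^ 2 + 1)) := by
  have h : t ^ 2 + 1 ≠ 0 := by positivity
  simp only [dist_sq_eq]
  simp [nelsonRealization, nelsonPosition, reflection₁, reflection₂]
  refine ⟨by ring, by ring, ?_, ?_⟩ <;> field_simp <;> ring

lemma continuous_vec3 {X : Type*} [TopologicalSpace X] {f g h : X → ℝ} (hf : Continuous f)
    (hg : Continuous g) (hh : Continuous h) : Continuous fun s => (!₂[f s, g s, h s] : E3) := by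
  refine (PiLp.continuous_toLp 2 _).comp (continuous_pi fun i => ?_)
  fin_cases i
  exacts [hf, hg, hh]

lemma continuous_nelsonRealization (μ : ℝ) : Continuous fun q : ℝ × ℝ × ℝ × ℝ × ℝ =>
    nelsonRealization q.1 q.2.1 q.2.2.1 q.2.2.2.1 q.2.2.2.2 μ := by
  have hcoord : ∀ i, Continuous fun p : E3 => p i := fun i => by fun_prop
  have hr1 : Continuous reflection₁ :=
    continuous_vec3 (hcoord 0) (hcoord 1).neg (hcoord 2).neg
  have hr2 : Continuous fun q : ℝ × E3 => reflection₂ q.1 q.2 := by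
    have hne : ∀ q : ℝ × E3, q.1 ^ 2 + 1 ≠ 0 := fun q => by positivity
    have hc : Continuous fun q : ℝ × E3 => (q.1 ^ 2 - 1) / (q.1 ^ 2 + 1) :=
      Continuous.div (by fun_prop) (by fun_prop) hne
    have hs : Continuous fun q : ℝ × E3 => 2 * q.1 / (q.1 ^ 2 + 1) :=
      Continuous.div (by fun_prop) (by fun_prop) hne
    have hi : ∀ i, Continuous fun q : ℝ × E3 => q.2 i := fun i => by fun_prop
    exact continuous_vec3 ((hc.mul (hi 0)).add (hs.mul (hi 1)))
      ((hs.mul (hi 0)).sub (hc.mul (hi 1))) (hi 2).neg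
  have hcross : Continuous fun q : E3 × E3 => cross q.1 q.2 := by
    have : ∀ q : E3 × E3, cross q.1 q.2 = !₂[q.1 1 * q.2 2 - q.1 2 * q.2 1,
        q.1 2 * q.2 0 - q.1 0 * q.2 2, q.1 0 * q.2 1 - q.1 1 * q.2 0] := fun q => by
      rw [cross, cross_apply]
    simp only [this]
    exact continuous_vec3 (by fun_prop) (by fun_prop) (by fun_prop)
  have hnew : Continuous fun q : E3 × E3 × E3 => newVertex q.1 q.2.1 q.2.2 := by
    have h : Continuous fun q : E3 × E3 × E3 => cross (q.2.1 - q.1) (q.2.2 - q.1) :=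
      hcross.comp (f := fun q : E3 × E3 × E3 => (q.2.1 - q.1, q.2.2 - q.1)) (by fun_prop)
    unfold newVertex
    fun_prop
  have hp3 : Continuous fun q : ℝ × ℝ × ℝ × ℝ × ℝ =>
      (!₂[q.2.2.1, q.2.2.2.1, q.2.2.2.2] : E3) :=
    continuous_vec3 (by fun_prop) (by fun_prop) (by fun_prop)
  have hp1 := hr1.comp hp3
  have hp5 := hr2.comp (continuous_fst.prodMk hp3)
  have hp0 := (hp1.const_smul μ).add (hp5.const_smul (1 - μ))
  have hp2 := hr1.comp hp0
  have hB : Continuous fun q : ℝ × ℝ × ℝ × ℝ × ℝ => (!₂[0, 0, -q.2.1] : E3) :=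
    continuous_vec3 (by fun_prop) (by fun_prop) (by fun_prop)
  have hT : Continuous fun q : ℝ × ℝ × ℝ × ℝ × ℝ => (!₂[0, 0, q.2.1] : E3) :=
    continuous_vec3 (by fun_prop) (by fun_prop) (by fun_prop)
  refine continuous_pi fun v => ?_
  cases v
  · exact hT
  · exact hB
  · exact hp1
  · exact hp2
  · exact hp3
  · exact hr2.comp (continuous_fst.prodMk hp0)
  · exact hp5
  · have h := hnew.comp (hp1.prodMk (hp2.prodMk hB))
    simp only [Function.comp_def] at h
    simp only [nelsonRealization, nelsonPosition]
    exact h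

/-- The special realization moves in a family of Nelson realizations with fixed edge lengths, along
which the half-distance `a` of the apices determines the time. -/
lemma exists_nelson_family : ∃ t a x y z : ℝ → ℝ,
    (t 0 = -5 / 8 ∧ a 0 = 1 ∧ x 0 = 15 / 7 ∧ y 0 = 11 / 4 ∧ z 0 = 5 / 2) ∧
    ∀ᶠ s in 𝓝 0, (ContinuousAt t s ∧ ContinuousAt a s ∧ ContinuousAt x s ∧ ContinuousAt y s ∧
        ContinuousAt z s) ∧
      0 < a s ∧ a s * z s = 5 / 2 ∧ z s ^ 2 + a s ^ 2 = 29 / 4 + s ∧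
      x s ^ 2 + y s ^ 2 = 9529 / 784 - s ∧
      x s ^ 2 + y s ^ 2 = 38116 / 4361 * (t s ^ 2 + 1) ∧
      2 / 7 * y s ^ 2 * (t s ^ 2 + 1) + (1 - 2 / 7) * (x s - t s * y s) ^ 2 =
        (7849187 / 488432 - z s ^ 2) * (t s ^ 2 + 1) := by
  -- At the special parameters `x² + y² = 9529/784`, `z² + a² = 29/4` and `(z ± a)² = 29/4 ± 5`. The
  -- signs of the roots are those of the special parameters, where `t < 0` and `0 < a < z`.
  set ρ : ℝ → ℝ := fun s => 9529 / 784 - s with hρ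
  set t : ℝ → ℝ := fun s => -√(ρ s * (4361 / 38116) - 1) with ht
  set a : ℝ → ℝ := fun s => (√(49 / 4 + s) - √(9 / 4 + s)) / 2 with ha
  set z : ℝ → ℝ := fun s => (√(49 / 4 + s) + √(9 / 4 + s)) / 2 with hz
  have ht0 : t 0 = -5 / 8 := by
    have : ρ 0 * (4361 / 38116) - 1 = (5 / 8) ^ 2 := by norm_num [hρ]
    simp only [ht, this]
    rw [Real.sqrt_sq (by norm_num)]
    norm_num
  have h49 : √(49 / 4 + 0) = 7 / 2 := by
    rw [show (49 / 4 + 0 : ℝ) = (7 / 2) ^ 2 by norm_num, Real.sqrt_sq (by norm_num)]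
  have h9 : √(9 / 4 + 0) = 3 / 2 := by
    rw [show (9 / 4 + 0 : ℝ) = (3 / 2) ^ 2 by norm_num, Real.sqrt_sq (by norm_num)]
  have ha0 : a 0 = 1 := by simp only [ha, h49, h9]; norm_num
  have hz0 : z 0 = 5 / 2 := by simp only [hz, h49, h9]; norm_num
  have htc : Continuous t := by fun_prop
  have hac : Continuous a := by fun_prop
  have hzc : Continuous z := by fun_prop
  have hρc : Continuous ρ := by fun_prop
  -- In terms of `P = x² - y²` and `Q = 2 x y`, the last equation of the statement, multiplied by `14`,
  -- is `α P + β Q = γ` with the following coefficients.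
  obtain ⟨x, y, hx0, hy0, hxy⟩ := exists_continuation_of_transverse
    (α := fun s => 3 - 7 * t s ^ 2) (β := fun s => -10 * t s)
    (γ := fun s => 7 * (t s ^ 2 + 1) * (2 * (7849187 / 488432 - z s ^ 2) - ρ s)) (ρ := ρ)
    (x₀ := 15 / 7) (y₀ := 11 / 4) (by fun_prop) (by fun_prop) (by fun_prop) hρc (by norm_num)
    (by norm_num [hρ]) (by simp only [ht0, hz0]; norm_num [hρ]) (by simp only [ht0]; norm_num)
  refine ⟨t, a, x, y, z, ⟨ht0, ha0, hx0, hy0, hz0⟩, ?_⟩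
  have ev1 : ∀ᶠ s in 𝓝 (0 : ℝ), 0 < a s :=
    continuousAt_const.eventually_lt hac.continuousAt (by rw [ha0]; norm_num)
  have ev2 : ∀ᶠ s in 𝓝 (0 : ℝ), -1 < s := lt_mem_nhds (by norm_num)
  have ev3 : ∀ᶠ s in 𝓝 (0 : ℝ), s < 1 := gt_mem_nhds (by norm_num)
  filter_upwards [hxy, ev1, ev2, ev3] with s hs h1 h2 h3
  obtain ⟨hxc, hyc, hcirc, hline⟩ := hs
  have hs49 : √(49 / 4 + s) ^ 2 = 49 / 4 + s := Real.sq_sqrt (by linarith)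
  have hs9 : √(9 / 4 + s) ^ 2 = 9 / 4 + s := Real.sq_sqrt (by linarith)
  have htsq : t s ^ 2 = ρ s * (4361 / 38116) - 1 := by
    simp only [ht, neg_sq]
    exact Real.sq_sqrt (by simp only [hρ]; linarith)
  refine ⟨⟨htc.continuousAt, hac.continuousAt, hxc, hyc, hzc.continuousAt⟩, h1, ?_, ?_, hcirc, ?_,
    ?_⟩
  · simp only [ha, hz]
    linear_combination (hs49 - hs9) / 4
  · simp only [ha, hz]
    linear_combination (hs49 + hs9) / 2
  · rw [hcirc, htsq]
    ring
  · linear_combination (1 / 14 : ℝ) * hline + (t s ^ 2 + 1) / 2 * hcirc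

lemma dist_apices_nelsonRealization (t a x y z μ : ℝ) :
    dist (nelsonRealization t a x y z μ T) (nelsonRealization t a x y z μ B) ^ 2 = (2 * a) ^ 2 := by
  rw [dist_sq_eq]
  simp [nelsonRealization, nelsonPosition]
  ring

lemma Congruent.dist_eq {V : Type*} {p q : V → E3} (h : Congruent p q) (u v : V) :
    dist (p u) (p v) = dist (q u) (q v) := by
  obtain ⟨g, -, hg⟩ := h
  rw [← hg u, ← hg v, g.dist_map]

/-- The special realization has a flex without self-intersections: the family of Nelson
realizations, restricted to parameters so small that the placements remain embedded. -/
lemma exists_isEmbeddedFlex_specialRealization :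
    ∃ f : ℝ → Vertex → E3, IsEmbeddedFlex subdividedBipyramid specialRealization f := by
  obtain ⟨t, a, x, y, z, ⟨ht0, ha0, hx0, hy0, hz0⟩, hev⟩ := exists_nelson_family
  set p : ℝ → Vertex → E3 := fun s => nelsonRealization (t s) (a s) (x s) (y s) (z s) (2 / 7)
    with hp
  have hp0 : p 0 = specialRealization := by
    simp only [hp, ht0, ha0, hx0, hy0, hz0, nelsonRealization_special]
  have hcont : ∀ᶠ s in 𝓝 0, ContinuousAt p s := by
    filter_upwards [hev] with s hs
    obtain ⟨⟨htc, hac, hxc, hyc, hzc⟩, -⟩ := hs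
    exact ContinuousAt.comp (f := fun s => (t s, a s, x s, y s, z s))
      (continuous_nelsonRealization (2 / 7)).continuousAt
      (htc.prodMk (hac.prodMk (hxc.prodMk (hyc.prodMk hzc))))
  have hinj : ∀ᶠ s in 𝓝 0, Function.Injective (realizationMap subdividedBipyramid (p s)) := by
    have h := hcont.self_of_nhds
    rw [ContinuousAt, hp0] at h
    exact h.eventually eventually_injective_realizationMap
  obtain ⟨δ, hδ, hball⟩ := Metric.eventually_nhds_iff.1 (hev.and (hcont.and hinj))
  have hscale : ∀ τ ∈ Set.Ico (0 : ℝ) 1, dist (δ / 2 * τ) 0 < δ := by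
    rintro τ ⟨h0, h1⟩
    rw [Real.dist_0_eq_abs, abs_of_nonneg (by positivity)]
    nlinarith
  have hpoly : ∀ τ ∈ Set.Ico (0 : ℝ) 1, Function.Injective
      (realizationMap subdividedBipyramid (p (δ / 2 * τ))) :=
    fun τ hτ => (hball (hscale τ hτ)).2.2
  refine ⟨fun τ => p (δ / 2 * τ), ⟨?_, ?_, ?_, ?_, ?_⟩,
    fun τ hτ => isEmbeddedPolyhedron_of_injective (hpoly τ hτ)⟩
  · intro τ hτ
    exact (ContinuousAt.comp (f := fun τ => δ / 2 * τ) (hball (hscale τ hτ)).2.1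
      (by fun_prop)).continuousWithinAt
  · simp only [mul_zero, hp0]
  · intro τ hτ
    have h := hpoly τ hτ
    rw [subdividedBipyramid_eq] at h ⊢
    exact isRealization_of_injective h
  · intro τ hτ
    obtain ⟨-, -, haz, hza, hr, hrt, hμ⟩ := (hball (hscale τ hτ)).1
    rw [← nelsonRealization_special]
    generalize δ / 2 * τ = s at *
    obtain ⟨hB, hT, h5, h13⟩ :=
      dist_sq_nelsonRealization (t s) (a s) (x s) (y s) (z s) (2 / 7)
    obtain ⟨hB', hT', h5', h13'⟩ :=
      dist_sq_nelsonRealization (-5 / 8) 1 (15 / 7) (11 / 4) (5 / 2) (2 / 7)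
    have ht : t s ^ 2 + 1 ≠ 0 := by positivity
    refine sameEdgeLengths_nelsonRealization ?_ ?_ ?_ ?_
    · rw [hB, hB', hr, hza, haz]
      norm_num
    · rw [hT, hT', hr, hza, haz]
      norm_num
    · rw [h5, h5', hrt, mul_div_cancel_right₀ _ ht]
      norm_num
    · rw [h13, h13', hμ, mul_div_cancel_right₀ _ ht]
      norm_num
  · intro τ₁ h₁ τ₂ h₂ hne hcongr
    have hdist := congrArg (· ^ 2) (hcongr.dist_eq T B)
    simp only [hp, dist_apices_nelsonRealization] at hdist
    obtain ⟨-, ha₁, haz₁, hza₁, -⟩ := (hball (hscale τ₁ h₁)).1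
    obtain ⟨-, ha₂, haz₂, hza₂, -⟩ := (hball (hscale τ₂ h₂)).1
    have ha : a (δ / 2 * τ₁) = a (δ / 2 * τ₂) := by
      have := (sq_eq_sq₀ (by positivity) (by positivity)).1 hdist
      linarith
    have hz : z (δ / 2 * τ₁) = z (δ / 2 * τ₂) := by
      refine mul_left_cancel₀ ha₁.ne' ?_
      rw [haz₁, ha, haz₂]
    rw [ha, hz, hza₂] at hza₁
    have : δ / 2 * τ₁ = δ / 2 * τ₂ := by linarith
    exact hne (mul_left_cancel₀ (by positivity) this)

/-- Every element of `Vertex` is a vertex of the complex. -/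
lemma ncard_vertices_subdividedBipyramid :
    {v : Vertex | ({v} : Finset Vertex) ∈ subdividedBipyramid}.ncard = 8 := by
  have huniv : {v : Vertex | ({v} : Finset Vertex) ∈ subdividedBipyramid} = Set.univ := by
    refine Set.eq_univ_of_forall fun v => ?_
    rw [subdividedBipyramid_eq]
    have key : ∀ v : Vertex, ∃ τ ∈ subdividedFacets, {v} ⊆ τ := by decide +kernel
    exact ⟨Finset.singleton_nonempty v, key v⟩
  rw [huniv, Set.ncard_univ, Nat.card_eq_fintype_card]
  rfl

end FlexiblePolyhedron

end

theorem mainTheorem1 :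
    (∃ f : ℝ → FlexiblePolyhedron.Vertex → FlexiblePolyhedron.E3,
      FlexiblePolyhedron.IsEmbeddedFlex FlexiblePolyhedron.subdividedBipyramid
        FlexiblePolyhedron.specialRealization f) ∧
    (∃ (V : Type) (_ : Fintype V) (_ : DecidableEq V) (K : PreAbstractSimplicialComplex V)
      (p : V → FlexiblePolyhedron.E3) (f : ℝ → V → FlexiblePolyhedron.E3),
      {v : V | ({v} : Finset V) ∈ K}.ncard = 8 ∧ FlexiblePolyhedron.IsEmbeddedFlex K p f) := by
  obtain ⟨f, hf⟩ := FlexiblePolyhedron.exists_isEmbeddedFlex_specialRealization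
  exact ⟨⟨f, hf⟩, FlexiblePolyhedron.Vertex, inferInstance, inferInstance,
    FlexiblePolyhedron.subdividedBipyramid, FlexiblePolyhedron.specialRealization, f,
    FlexiblePolyhedron.ncard_vertices_subdividedBipyramid, hf⟩
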